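/- Let $F$ be Thompson's group, i.e. the group, under composition, of all orientation-preserving piecewise linear homeomorphisms of $[0,1]$ with finitely many breakpoints, all of them dyadic rationals, and with all slopes integral powers of $2$. Let $F'=[F,F]$ be its commutator subgroup. For $f\in F'$ let $C(f)=\{hfh^{-1} : h\in F'\}$ be the conjugacy class of $f$ in $F'$, and let $C(f)^{\pm1}=C(f)\cup C(f)^{-1}$. Let $f$ be an arbitrary nonidentity element of $F'$. Then every element of $F'$ is a product of at most six elements of $C(f)^{\pm1}$. Consequently, $F'$ is a group of finite $C$-width: for every generating set $S$ of $F'$ that is invariant under all inner automorphisms of $F'$, there is a natural number $k$ such that every element of $F'$ is a product of at most $k$ elements of $S\cup S^{-1}$. -/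

import Mathlib

open scoped Pointwise

/-! ### Width of a group -/

/-- The length of `g` with respect to `S`: the least number of elements of `S ∪ S⁻¹` whose
product is `g` (and `⊤` if there is no such product). -/
noncomputable def wordLength {G : Type*} [Group G] (S : Set G) (g : G) : ℕ∞ :=
  ⨅ (l : List G) (_ : (∀ x ∈ l, x ∈ S ∪ S⁻¹) ∧ l.prod = g), (l.length : ℕ∞)

/-- The width of `G` with respect to `S`. -/
noncomputable def groupWidth (G : Type*) [Group G] (S : Set G) : ℕ∞ :=
  ⨆ g : G, wordLength S g

/-- `S` is invariant under all inner automorphisms. -/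
def IsConjInvariant {G : Type*} [Group G] (S : Set G) : Prop :=
  ∀ g : G, ∀ s ∈ S, g * s * g⁻¹ ∈ S

/-- `G` is a group of finite `C`-width: it has finite width with respect to every
conjugation-invariant generating set. -/
def HasFiniteCWidth (G : Type*) [Group G] : Prop :=
  ∀ S : Set G, Subgroup.closure S = ⊤ → IsConjInvariant S → groupWidth G S ≠ ⊤

/-! ### Thompson's group `F = PL₂([0,1])` -/

/-- Dyadic rationals, the elements of `ℤ[1/2]`. -/
def IsDyadicReal (x : ℝ) : Prop := ∃ (m : ℤ) (n : ℕ), x = m / 2 ^ n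

theorem IsDyadicReal.zero : IsDyadicReal 0 := ⟨0, 0, by simp⟩

theorem IsDyadicReal.add {x y : ℝ} (hx : IsDyadicReal x) (hy : IsDyadicReal y) :
    IsDyadicReal (x + y) := by
  obtain ⟨m, n, rfl⟩ := hx
  obtain ⟨p, q, rfl⟩ := hy
  refine ⟨m * 2 ^ q + p * 2 ^ n, n + q, ?_⟩
  push_cast
  field_simp
  ring

theorem IsDyadicReal.sub {x y : ℝ} (hx : IsDyadicReal x) (hy : IsDyadicReal y) :
    IsDyadicReal (x - y) := by
  obtain ⟨m, n, rfl⟩ := hx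
  obtain ⟨p, q, rfl⟩ := hy
  refine ⟨m * 2 ^ q - p * 2 ^ n, n + q, ?_⟩
  push_cast
  field_simp
  ring

theorem IsDyadicReal.zpow_mul {x : ℝ} (k : ℤ) (hx : IsDyadicReal x) :
    IsDyadicReal ((2 : ℝ) ^ k * x) := by
  obtain ⟨m, n, rfl⟩ := hx
  obtain ⟨j, rfl | rfl⟩ := k.eq_nat_or_neg
  · exact ⟨2 ^ j * m, n, by push_cast; rw [zpow_natCast]; ring⟩
  · exact ⟨m, n + j, by rw [zpow_neg, zpow_natCast]; field_simp; ring⟩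

/-- An increasing self-bijection `f` of `[0,1]` (that is, an orientation-preserving
homeomorphism) is piecewise linear with finitely many breakpoints, all of them dyadic, and with
slopes integral powers of two: there is a finite set `D` of dyadic points such that on every
interval `[a,b]` with no point of `D` in its interior `f` is affine of slope `2 ^ k`, `k ∈ ℤ`. -/
def IsPLTwo (f : unitInterval ≃o unitInterval) : Prop :=
  ∃ D : Finset unitInterval, (∀ d ∈ D, IsDyadicReal (d : ℝ)) ∧
    ∀ a b : unitInterval, (∀ d ∈ D, d ∉ Set.Ioo a b) →
      ∃ k : ℤ, ∀ x ∈ Set.Icc a b, ∀ y ∈ Set.Icc a b,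
        ((f y : unitInterval) : ℝ) - f x = (2 : ℝ) ^ k * ((y : ℝ) - x)

theorem IsPLTwo.dyadic {f : unitInterval ≃o unitInterval} (hf : IsPLTwo f) (x : unitInterval)
    (hx : IsDyadicReal (x : ℝ)) : IsDyadicReal ((f x : unitInterval) : ℝ) := by
  classical
  obtain ⟨D, hD, h⟩ := hf
  have key : ∀ a x : unitInterval, a ≤ x → (∀ d ∈ D, d ∉ Set.Ioo a x) →
      IsDyadicReal (a : ℝ) → IsDyadicReal ((f a : unitInterval) : ℝ) → IsDyadicReal (x : ℝ) →
      IsDyadicReal ((f x : unitInterval) : ℝ) := by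
    intro a x hax hd ha hfa hx
    obtain ⟨k, hk⟩ := h a x hd
    have e := hk a ⟨le_rfl, hax⟩ x ⟨hax, le_rfl⟩
    rw [sub_eq_iff_eq_add] at e
    rw [e]
    exact ((hx.sub ha).zpow_mul k).add hfa
  induction hn : (D.filter (· < x)).card using Nat.strong_induction_on generalizing x with
  | _ n ih =>
    by_cases hne : (D.filter (· < x)).Nonempty
    · have hm := Finset.max'_mem _ hne
      set a := (D.filter (· < x)).max' hne with ha
      obtain ⟨haD, hax⟩ := Finset.mem_filter.1 hm
      refine key a x hax.le ?_ (hD a haD) (ih _ ?_ a (hD a haD) rfl) hx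
      · intro d hd hdI
        exact absurd (Finset.le_max' _ d (Finset.mem_filter.2 ⟨hd, hdI.2⟩)) (not_le.2 hdI.1)
      · rw [← hn]
        apply Finset.card_lt_card
        refine ⟨fun d hd => ?_, fun hs => ?_⟩
        · obtain ⟨h1, h2⟩ := Finset.mem_filter.1 hd
          exact Finset.mem_filter.2 ⟨h1, h2.trans hax⟩
        · exact lt_irrefl a (Finset.mem_filter.1 (hs hm)).2
    · refine key 0 x unitInterval.nonneg' ?_ (by simpa using IsDyadicReal.zero) ?_ hx
      · intro d hd hdI
        exact hne ⟨d, Finset.mem_filter.2 ⟨hd, hdI.2⟩⟩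
      · have : f 0 = 0 := f.map_bot
        rw [this]
        simpa using IsDyadicReal.zero

theorem IsPLTwo.one : IsPLTwo 1 :=
  ⟨∅, by simp, fun _ _ _ => ⟨0, fun x _ y _ => by simp [RelIso.one_apply]⟩⟩

theorem IsPLTwo.inv {f : unitInterval ≃o unitInterval} (hf : IsPLTwo f) : IsPLTwo f⁻¹ := by
  classical
  have hdy := hf.dyadic
  obtain ⟨D, hD, h⟩ := hf
  refine ⟨D.image f, ?_, fun a b hab => ?_⟩
  · intro d hd
    obtain ⟨e, he, rfl⟩ := Finset.mem_image.1 hd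
    exact hdy e (hD e he)
  · obtain ⟨k, hk⟩ := h (f.symm a) (f.symm b) (fun d hd hI => hab (f d)
      (Finset.mem_image_of_mem _ hd) ⟨(f.symm_apply_lt).1 hI.1, (f.lt_symm_apply).1 hI.2⟩)
    refine ⟨-k, fun x hx y hy => ?_⟩
    have e := hk (f.symm x) ⟨f.symm.monotone hx.1, f.symm.monotone hx.2⟩
      (f.symm y) ⟨f.symm.monotone hy.1, f.symm.monotone hy.2⟩
    simp only [OrderIso.apply_symm_apply] at e
    change ((f.symm y : unitInterval) : ℝ) - f.symm x = _
    rw [e, ← mul_assoc, ← zpow_add₀ two_ne_zero]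
    simp

theorem IsPLTwo.mul {f g : unitInterval ≃o unitInterval} (hf : IsPLTwo f) (hg : IsPLTwo g) :
    IsPLTwo (f * g) := by
  classical
  have hdy := hg.inv.dyadic
  obtain ⟨D, hD, h⟩ := hf
  obtain ⟨E, hE, h'⟩ := hg
  refine ⟨E ∪ D.image g.symm, ?_, fun a b hab => ?_⟩
  · intro d hd
    rcases Finset.mem_union.1 hd with hd | hd
    · exact hE d hd
    · obtain ⟨e, he, rfl⟩ := Finset.mem_image.1 hd
      exact hdy e (hD e he)
  · obtain ⟨k, hk⟩ := h' a b (fun d hd => hab d (Finset.mem_union_left _ hd))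
    obtain ⟨l, hl⟩ := h (g a) (g b) (fun d hd hI => hab (g.symm d)
      (Finset.mem_union_right _ (Finset.mem_image_of_mem _ hd))
      ⟨(g.lt_symm_apply).2 hI.1, (g.symm_apply_lt).2 hI.2⟩)
    refine ⟨l + k, fun x hx y hy => ?_⟩
    have e := hl (g x) ⟨g.monotone hx.1, g.monotone hx.2⟩
      (g y) ⟨g.monotone hy.1, g.monotone hy.2⟩
    rw [RelIso.mul_apply, RelIso.mul_apply, e, hk x hx y hy, zpow_add₀ two_ne_zero, mul_assoc]

/-- Thompson's group `F`, realized as `PL₂([0,1])` under composition. -/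
def thompsonF : Subgroup (unitInterval ≃o unitInterval) where
  carrier := {f | IsPLTwo f}
  one_mem' := IsPLTwo.one
  mul_mem' := IsPLTwo.mul
  inv_mem' := IsPLTwo.inv

open scoped commutatorElement

/-! ### Commutators in a group with displaced subgroups -/

/-! Extending by the identity turns F into `plSupported 0 1`, a group of homeomorphisms of the line.
There one may also conjugate by piecewise linear maps that do not preserve [0,1]. `IsRealPL` asks
for preservation of dyadics because on the line, unlike on [0,1], no fixed dyadic point forces it.

Germs at 0 and 1 of elements of F are homotheties and commute, so an element g of F' has compact
support in (0,1); moreover g is a product of commutators of elements of F supported in one compact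
interval (`exists_mem_commutator_plSupported`). An element t pushing that interval off itself to the
right lets shifted copies of such a product telescope, so that g = ⁅α, β⁆ * ⁅w, t⁆
(`exists_eq_two_commutators`).

A nonidentity f displaces some interval (a,b). As compact intervals of (0,1) can be moved into any
other (`exists_compress`), g has a conjugate that is a product of two commutators of elements
supported in (a,b). Commutators with f then express it by six conjugates of f and its inverse
(`two_commutators_eq_six_conjugates`). Finally the conjugators, so far only compactly supported, are
replaced by elements of F' (`exists_commutator_conj_eq`). -/

theorem commutator_self_le {G : Type*} [Group G] (H : Subgroup G) : ⁅H, H⁆ ≤ H :=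
  Subgroup.commutator_le.2 fun _ hx _ hy =>
    H.mul_mem (H.mul_mem (H.mul_mem hx hy) (H.inv_mem hx)) (H.inv_mem hy)

theorem commutatorElement_mul_mul_of_commute {G : Type*} [Group G] {a b c d : G}
    (hac : Commute a c) (had : Commute a d) (hbc : Commute b c) (hbd : Commute b d) :
    ⁅a * c, b * d⁆ = ⁅a, b⁆ * ⁅c, d⁆ := by
  have h2 : Commute (c * d * c⁻¹) b⁻¹ :=
    ((hbc.symm.inv_right.mul_left hbd.symm.inv_right).mul_left hbc.symm.inv_right.inv_left)
  have h3 : Commute (c * d * c⁻¹) a⁻¹ :=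
    ((hac.symm.inv_right.mul_left had.symm.inv_right).mul_left hac.symm.inv_right.inv_left)
  calc ⁅a * c, b * d⁆ = a * (c * b) * d * c⁻¹ * a⁻¹ * d⁻¹ * b⁻¹ := by
        rw [commutatorElement_def]; group
    _ = a * b * ((c * d * c⁻¹) * a⁻¹) * d⁻¹ * b⁻¹ := by rw [hbc.symm.eq]; group
    _ = a * b * a⁻¹ * (c * d * c⁻¹) * (d⁻¹ * b⁻¹) := by rw [h3.eq]; group
    _ = a * b * a⁻¹ * ((c * d * c⁻¹) * b⁻¹) * d⁻¹ := by
        rw [(hbd.inv_inv.symm).eq]; group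
    _ = ⁅a, b⁆ * ⁅c, d⁆ := by
        rw [h2.eq, commutatorElement_def, commutatorElement_def]; group

/-- If `t` shifts `M` into itself so that the shifted group commutes with `P ≤ M`, then every
product of commutators of elements of `P` is a product of two commutators. -/
theorem exists_eq_two_commutators {G : Type*} [Group G] {P M : Subgroup G} {t : G} (hPM : P ≤ M)
    (htM : ∀ m ∈ M, t * m * t⁻¹ ∈ M) (hcomm : ∀ p ∈ P, ∀ m ∈ M, Commute p (t * m * t⁻¹))
    {g : G} (hg : g ∈ ⁅P, P⁆) :
    ∃ α ∈ M, ∃ β ∈ M, ∃ w ∈ M, g = ⁅α, β⁆ * ⁅w, t⁆ := by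
  have step : ∀ a ∈ P, ∀ b ∈ P, ∀ g ∈ ⁅P, P⁆,
      (∃ α ∈ M, ∃ β ∈ M, ∃ w ∈ M, g = ⁅α, β⁆ * ⁅w, t⁆) →
      ∃ α ∈ M, ∃ β ∈ M, ∃ w ∈ M, ⁅a, b⁆ * g = ⁅α, β⁆ * ⁅w, t⁆ := by
    rintro a ha b hb g hg ⟨α, hα, β, hβ, w, hw, e⟩
    have hgP : g ∈ P := commutator_self_le P hg
    have hgM := hPM hgP
    -- The first new commutator splits as ⁅a, b⁆ times t⁅α, β⁆t⁻¹. The second equals t(⁅w, t⁆g⁻¹)t⁻¹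
    -- times g, so the shifted copy of g cancels and ⁅a, b⁆ * g remains.
    refine ⟨a * (t * α * t⁻¹), M.mul_mem (hPM ha) (htM α hα), b * (t * β * t⁻¹),
      M.mul_mem (hPM hb) (htM β hβ), g * (t * w * t⁻¹), M.mul_mem hgM (htM w hw), ?_⟩
    rw [commutatorElement_mul_mul_of_commute (hcomm a ha α hα) (hcomm a ha β hβ)
      (hcomm b hb α hα) (hcomm b hb β hβ)]
    have hm := hcomm g hgP (w * (t * w⁻¹ * t⁻¹) * g⁻¹)
      (M.mul_mem (M.mul_mem hw (htM _ (M.inv_mem hw))) (M.inv_mem hgM))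
    have e1 : ⁅g * (t * w * t⁻¹), t⁆ = g * (t * (w * (t * w⁻¹ * t⁻¹) * g⁻¹) * t⁻¹) := by
      rw [commutatorElement_def]; group
    have e2 : ⁅t * α * t⁻¹, t * β * t⁻¹⁆ = t * ⁅α, β⁆ * t⁻¹ := by
      rw [commutatorElement_def, commutatorElement_def]; group
    have e3 : w * (t * w⁻¹ * t⁻¹) = ⁅w, t⁆ := by rw [commutatorElement_def]; group
    rw [e1, hm.eq, e2, e3]
    have e4 : ⁅α, β⁆ * ⁅w, t⁆ * g⁻¹ = 1 := by rw [← e, mul_inv_cancel]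
    calc ⁅a, b⁆ * g = ⁅a, b⁆ * (t * (⁅α, β⁆ * ⁅w, t⁆ * g⁻¹) * t⁻¹) * g := by
          rw [e4, mul_one, mul_inv_cancel, mul_one]
      _ = _ := by simp only [mul_assoc, inv_mul_cancel_left]
  rw [Subgroup.commutator_def] at hg
  induction hg using Subgroup.closure_induction_left with
  | one => exact ⟨1, M.one_mem, 1, M.one_mem, 1, M.one_mem, by simp⟩
  | mul_left x hx y hy ih =>
    obtain ⟨a, ha, b, hb, rfl⟩ := hx
    exact step a ha b hb y hy ih
  | inv_mul_cancel x hx y hy ih =>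
    obtain ⟨a, ha, b, hb, rfl⟩ := hx
    rw [commutatorElement_inv]
    exact step b hb a ha y hy ih

/-- If `f` displaces `U ≤ K`, a product of two commutators in `U` is a product of six elements
conjugate under `K` to `f` or `f⁻¹`. -/
theorem two_commutators_eq_six_conjugates {G : Type*} [Group G] {U K : Subgroup G} {f : G}
    (hUK : U ≤ K) (hf : f ∈ K) (hcomm : ∀ a ∈ U, ∀ b ∈ U, Commute a (f * b * f⁻¹))
    {x p q y : G} (hx : x ∈ U) (hp : p ∈ U) (hq : q ∈ U) (hy : y ∈ U) :
    ∃ l : List G, l.length ≤ 6 ∧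
      (∀ s ∈ l, ∃ k ∈ K, s = k * f * k⁻¹ ∨ s = k * f⁻¹ * k⁻¹) ∧ l.prod = ⁅x, p⁆ * ⁅q, y⁆ := by
  have pair : ∀ a ∈ U, ∀ r ∈ U, ∀ z ∈ K, ∃ l : List G, l.length = 2 ∧
      (∀ s ∈ l, ∃ k ∈ K, s = k * f * k⁻¹ ∨ s = k * f⁻¹ * k⁻¹) ∧
        l.prod = z * (a * (f * (r * a⁻¹ * r⁻¹) * f⁻¹)) * z⁻¹ := by
    intro a ha r hr z hz
    have hc : f * r * f⁻¹ ∈ K := K.mul_mem (K.mul_mem hf (hUK hr)) (K.inv_mem hf)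
    -- With c = f r f⁻¹ the product is the conjugate by z c of a(f a⁻¹ f⁻¹). Since c commutes with
    -- a, it only conjugates the displaced factor.
    refine ⟨[(z * (f * r * f⁻¹) * a) * f * (z * (f * r * f⁻¹) * a)⁻¹,
      (z * (f * r * f⁻¹)) * f⁻¹ * (z * (f * r * f⁻¹))⁻¹], rfl, ?_, ?_⟩
    · intro s hs
      simp only [List.mem_cons, List.not_mem_nil, or_false] at hs
      rcases hs with rfl | rfl
      · exact ⟨_, K.mul_mem (K.mul_mem hz hc) (hUK ha), Or.inl rfl⟩
      · exact ⟨_, K.mul_mem hz hc, Or.inr rfl⟩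
    · have h := (hcomm a ha r hr).eq
      calc _ = z * ((f * r * f⁻¹) * a) * (f * a⁻¹ * r⁻¹ * f⁻¹) * z⁻¹ := by
            simp only [List.prod_cons, List.prod_nil]; group
        _ = _ := by rw [← h]; group
  have hpx : p * x⁻¹ * p⁻¹ ∈ U := U.mul_mem (U.mul_mem hp (U.inv_mem hx)) (U.inv_mem hp)
  have hqy : q * y * q⁻¹ ∈ U := U.mul_mem (U.mul_mem hq hy) (U.inv_mem hq)
  have hyx : y⁻¹ * x ∈ U := U.mul_mem (U.inv_mem hy) hx
  -- Conjugating ⁅x, p⁆⁅q, y⁆ by y⁻¹ gives (y⁻¹x)(px⁻¹p⁻¹)(qyq⁻¹). The three values of r turn the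
  -- inverses of these factors into x⁻¹y, y⁻¹xy and y⁻¹, whose product is 1; hence the displaced
  -- parts cancel.
  obtain ⟨l₁, n₁, h₁, e₁⟩ := pair (y⁻¹ * x) hyx 1 U.one_mem y (hUK hy)
  obtain ⟨l₂, n₂, h₂, e₂⟩ := pair (p * x⁻¹ * p⁻¹) hpx (y⁻¹ * p⁻¹)
    (U.mul_mem (U.inv_mem hy) (U.inv_mem hp)) y (hUK hy)
  obtain ⟨l₃, n₃, h₃, e₃⟩ := pair (q * y * q⁻¹) hqy q⁻¹ (U.inv_mem hq) y (hUK hy)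
  refine ⟨l₁ ++ l₂ ++ l₃, by simp [n₁, n₂, n₃], ?_, ?_⟩
  · intro s hs
    simp only [List.mem_append] at hs
    rcases hs with (hs | hs) | hs
    exacts [h₁ s hs, h₂ s hs, h₃ s hs]
  · have c₁ := (hcomm _ hpx (x⁻¹ * y) (U.mul_mem (U.inv_mem hx) hy)).eq
    have c₂ := (hcomm _ hqy y hy).eq
    rw [List.prod_append, List.prod_append, e₁, e₂, e₃]
    calc _ = y * (y⁻¹ * x) * ((f * (x⁻¹ * y) * f⁻¹) * (p * x⁻¹ * p⁻¹)) *
              (f * (y⁻¹ * x * y) * f⁻¹) * (q * y * q⁻¹) * (f * y⁻¹ * f⁻¹) * y⁻¹ := by group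
      _ = y * (y⁻¹ * x) * (p * x⁻¹ * p⁻¹) * ((f * y * f⁻¹) * (q * y * q⁻¹)) *
              (f * y⁻¹ * f⁻¹) * y⁻¹ := by rw [← c₁]; group
      _ = _ := by rw [← c₂, commutatorElement_def, commutatorElement_def]; group

/-! ### Piecewise linear homeomorphisms of the line -/

theorem IsDyadicReal.mul_zpow_add {x p : ℝ} (k : ℤ) (hx : IsDyadicReal x) (hp : IsDyadicReal p) :
    IsDyadicReal (p + (2 : ℝ) ^ k * (x - p)) :=
  hp.add ((hx.sub hp).zpow_mul k)

theorem IsDyadicReal.one : IsDyadicReal 1 := ⟨1, 0, by simp⟩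

theorem exists_isDyadicReal_between {a b : ℝ} (hab : a < b) :
    ∃ x, IsDyadicReal x ∧ a < x ∧ x < b := by
  obtain ⟨n, hn⟩ := exists_pow_lt_of_lt_one (sub_pos.2 hab) (by norm_num : (1 / 2 : ℝ) < 1)
  have h2 : (0 : ℝ) < 2 ^ n := by positivity
  rw [one_div, inv_pow, inv_lt_iff_one_lt_mul₀ h2] at hn
  refine ⟨(⌊a * 2 ^ n⌋ + 1 : ℤ) / 2 ^ n, ⟨_, n, rfl⟩, ?_, ?_⟩
  · rw [lt_div_iff₀ h2]; push_cast; exact Int.lt_floor_add_one _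
  · rw [div_lt_iff₀ h2]; push_cast
    have := Int.floor_le (a * 2 ^ n)
    nlinarith

/-- Increasing bijections of `ℝ` that preserve the dyadic rationals and are piecewise linear with
finitely many breakpoints, all dyadic, and slopes integral powers of two. -/
def IsRealPL (f : ℝ ≃o ℝ) : Prop :=
  (∀ x, IsDyadicReal (f x) ↔ IsDyadicReal x) ∧
  ∃ D : Finset ℝ, (∀ d ∈ D, IsDyadicReal d) ∧
    ∀ a b : ℝ, (∀ d ∈ D, d ∉ Set.Ioo a b) →
      ∃ k : ℤ, ∀ x ∈ Set.Icc a b, ∀ y ∈ Set.Icc a b, f y - f x = (2 : ℝ) ^ k * (y - x)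

theorem IsRealPL.one : IsRealPL 1 :=
  ⟨fun _ => Iff.rfl, ∅, by simp, fun _ _ _ => ⟨0, fun x _ y _ => by simp [RelIso.one_apply]⟩⟩

theorem IsRealPL.inv {f : ℝ ≃o ℝ} (hf : IsRealPL f) : IsRealPL f⁻¹ := by
  classical
  obtain ⟨hdy, D, hD, h⟩ := hf
  refine ⟨fun x => ?_, D.image f, ?_, fun a b hab => ?_⟩
  · rw [← hdy, RelIso.apply_inv_self]
  · intro d hd
    obtain ⟨e, he, rfl⟩ := Finset.mem_image.1 hd
    exact (hdy e).2 (hD e he)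
  · obtain ⟨k, hk⟩ := h (f.symm a) (f.symm b) (fun d hd hI => hab (f d)
      (Finset.mem_image_of_mem _ hd) ⟨(f.symm_apply_lt).1 hI.1, (f.lt_symm_apply).1 hI.2⟩)
    refine ⟨-k, fun x hx y hy => ?_⟩
    have e := hk (f.symm x) ⟨f.symm.monotone hx.1, f.symm.monotone hx.2⟩
      (f.symm y) ⟨f.symm.monotone hy.1, f.symm.monotone hy.2⟩
    simp only [OrderIso.apply_symm_apply] at e
    change f.symm y - f.symm x = _
    rw [e, ← mul_assoc, ← zpow_add₀ two_ne_zero]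
    simp

theorem IsRealPL.mul {f g : ℝ ≃o ℝ} (hf : IsRealPL f) (hg : IsRealPL g) : IsRealPL (f * g) := by
  classical
  obtain ⟨hdf, D, hD, h⟩ := hf
  obtain ⟨hdg, E, hE, h'⟩ := hg
  refine ⟨fun x => ?_, E ∪ D.image g.symm, ?_, fun a b hab => ?_⟩
  · rw [RelIso.mul_apply, hdf, hdg]
  · intro d hd
    rcases Finset.mem_union.1 hd with hd | hd
    · exact hE d hd
    · obtain ⟨e, he, rfl⟩ := Finset.mem_image.1 hd
      rw [← hdg, OrderIso.apply_symm_apply]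
      exact hD e he
  · obtain ⟨k, hk⟩ := h' a b (fun d hd => hab d (Finset.mem_union_left _ hd))
    obtain ⟨l, hl⟩ := h (g a) (g b) (fun d hd hI => hab (g.symm d)
      (Finset.mem_union_right _ (Finset.mem_image_of_mem _ hd))
      ⟨(g.lt_symm_apply).2 hI.1, (g.symm_apply_lt).2 hI.2⟩)
    refine ⟨l + k, fun x hx y hy => ?_⟩
    have e := hl (g x) ⟨g.monotone hx.1, g.monotone hx.2⟩
      (g y) ⟨g.monotone hy.1, g.monotone hy.2⟩
    rw [RelIso.mul_apply, RelIso.mul_apply, e, hk x hx y hy, zpow_add₀ two_ne_zero, mul_assoc]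

/-! ### Homeomorphisms with a single breakpoint -/

/-- The homeomorphism of `ℝ` fixing `p`, of slope `2 ^ j` left of `p` and `2 ^ k` right of it. -/
noncomputable def kinkFun (p : ℝ) (j k : ℤ) (x : ℝ) : ℝ :=
  if x ≤ p then p + (2 : ℝ) ^ j * (x - p) else p + (2 : ℝ) ^ k * (x - p)

theorem kinkFun_of_le {p x : ℝ} (j k : ℤ) (h : x ≤ p) :
    kinkFun p j k x = p + (2 : ℝ) ^ j * (x - p) := if_pos h

theorem kinkFun_of_ge {p x : ℝ} (j k : ℤ) (h : p ≤ x) :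
    kinkFun p j k x = p + (2 : ℝ) ^ k * (x - p) := by
  rcases h.eq_or_lt with rfl | h
  · simp [kinkFun]
  · exact if_neg (not_le.2 h)

theorem kinkFun_neg_kinkFun (p : ℝ) (j k : ℤ) (x : ℝ) :
    kinkFun p (-j) (-k) (kinkFun p j k x) = x := by
  have hj : (0 : ℝ) < 2 ^ j := by positivity
  have hk : (0 : ℝ) < 2 ^ k := by positivity
  rcases le_total x p with h | h
  · rw [kinkFun_of_le j k h, kinkFun_of_le _ _ (by nlinarith), zpow_neg]
    field_simp; ring
  · rw [kinkFun_of_ge j k h, kinkFun_of_ge _ _ (by nlinarith), zpow_neg]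
    field_simp; ring

theorem kinkFun_strictMono (p : ℝ) (j k : ℤ) : StrictMono (kinkFun p j k) := by
  have hj : (0 : ℝ) < 2 ^ j := by positivity
  have hk : (0 : ℝ) < 2 ^ k := by positivity
  intro x y hxy
  rcases le_total x p with h | h
  · rcases le_or_gt y p with h' | h'
    · rw [kinkFun_of_le j k h, kinkFun_of_le j k h']; nlinarith
    · rw [kinkFun_of_le j k h, kinkFun_of_ge j k h'.le]; nlinarith [mul_pos hk (sub_pos.2 h')]
  · rw [kinkFun_of_ge j k h, kinkFun_of_ge j k (h.trans hxy.le)]; nlinarith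

/-- `kinkFun` as an order isomorphism. -/
noncomputable def kink (p : ℝ) (j k : ℤ) : ℝ ≃o ℝ :=
  (kinkFun_strictMono p j k).orderIsoOfRightInverse _ (kinkFun p (-j) (-k)) fun x => by
    simpa using kinkFun_neg_kinkFun p (-j) (-k) x

theorem kink_of_le {p x : ℝ} (j k : ℤ) (h : x ≤ p) :
    kink p j k x = p + (2 : ℝ) ^ j * (x - p) := kinkFun_of_le j k h

theorem kink_of_ge {p x : ℝ} (j k : ℤ) (h : p ≤ x) :
    kink p j k x = p + (2 : ℝ) ^ k * (x - p) := kinkFun_of_ge j k h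

theorem kink_zero_of_le {p x : ℝ} (k : ℤ) (h : x ≤ p) : kink p 0 k x = x := by
  rw [kink_of_le _ _ h, zpow_zero, one_mul, add_sub_cancel]

theorem IsDyadicReal.kinkFun {p x : ℝ} (hp : IsDyadicReal p) (j k : ℤ) (hx : IsDyadicReal x) :
    IsDyadicReal (kinkFun p j k x) := by
  unfold _root_.kinkFun
  split_ifs <;> exact hx.mul_zpow_add _ hp

theorem isRealPL_kink {p : ℝ} (hp : IsDyadicReal p) (j k : ℤ) : IsRealPL (kink p j k) := by
  refine ⟨fun x => ⟨fun h => ?_, fun h => hp.kinkFun j k h⟩, {p}, by simpa using hp, ?_⟩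
  · rw [← kinkFun_neg_kinkFun p j k x]
    exact hp.kinkFun (-j) (-k) h
  · intro a b h
    have h : ¬ (a < p ∧ p < b) := by simpa using h p
    rcases le_or_gt p a with hpa | hpa
    · refine ⟨k, fun x hx y hy => ?_⟩
      rw [kink_of_ge j k (hpa.trans hx.1), kink_of_ge j k (hpa.trans hy.1)]; ring
    · have hb : b ≤ p := not_lt.1 fun hb => h ⟨hpa, hb⟩
      refine ⟨j, fun x hx y hy => ?_⟩
      rw [kink_of_le j k (hx.2.trans hb), kink_of_le j k (hy.2.trans hb)]; ring

/-! ### Elements supported in an interval -/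

/-- Piecewise linear homeomorphisms of `ℝ` that are the identity outside `(a, b)`. -/
def plSupported (a b : ℝ) : Subgroup (ℝ ≃o ℝ) where
  carrier := {f | IsRealPL f ∧ ∀ x ∉ Set.Ioo a b, f x = x}
  one_mem' := ⟨IsRealPL.one, fun _ _ => rfl⟩
  mul_mem' := fun {f g} hf hg => ⟨hf.1.mul hg.1, fun x hx => by
    rw [RelIso.mul_apply, hg.2 x hx, hf.2 x hx]⟩
  inv_mem' := fun {f} hf => ⟨hf.1.inv, fun x hx => by
    nth_rewrite 1 [← hf.2 x hx]
    exact f.symm_apply_apply x⟩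

theorem plSupported_mono {a b c d : ℝ} (hca : c ≤ a) (hbd : b ≤ d) :
    plSupported a b ≤ plSupported c d :=
  fun _ hf => ⟨hf.1, fun x hx => hf.2 x fun h => hx ⟨hca.trans_lt h.1, h.2.trans_le hbd⟩⟩

theorem plSupported_conj {a b : ℝ} {f h : ℝ ≃o ℝ} (hh : IsRealPL h) (hf : f ∈ plSupported a b) :
    h * f * h⁻¹ ∈ plSupported (h a) (h b) := by
  refine ⟨(hh.mul hf.1).mul hh.inv, fun x hx => ?_⟩
  have e : f (h⁻¹ x) = h⁻¹ x := hf.2 _ fun hI => hx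
    ⟨(h.lt_symm_apply).1 hI.1, (h.symm_apply_lt).1 hI.2⟩
  rw [RelIso.mul_apply, RelIso.mul_apply, e, RelIso.apply_inv_self]

theorem plSupported_mem_Ioo {a b x : ℝ} {f : ℝ ≃o ℝ} (hf : f ∈ plSupported a b)
    (hx : x ∈ Set.Ioo a b) : f x ∈ Set.Ioo a b := by
  constructor
  · have := f.strictMono hx.1
    rwa [hf.2 a fun h => lt_irrefl _ h.1] at this
  · have := f.strictMono hx.2
    rwa [hf.2 b fun h => lt_irrefl _ h.2] at this

theorem plSupported_commute {a b c d : ℝ} {f g : ℝ ≃o ℝ} (hf : f ∈ plSupported a b)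
    (hg : g ∈ plSupported c d) (hbc : b ≤ c) : Commute f g := by
  ext x
  rw [RelIso.mul_apply, RelIso.mul_apply]
  by_cases h : x ∈ Set.Ioo a b
  · have h' := plSupported_mem_Ioo hf h
    rw [hg.2 x fun hI => (h.2.trans_le hbc).not_gt hI.1,
      hg.2 (f x) fun hI => (h'.2.trans_le hbc).not_gt hI.1]
  · rw [hf.2 x h]
    refine hf.2 _ fun hI => ?_
    by_cases h' : x ∈ Set.Ioo c d
    · exact (hI.2.trans_le hbc).not_gt (plSupported_mem_Ioo hg h').1
    · rw [hg.2 x h'] at hI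
      exact h hI

/-- Piecewise linear homeomorphisms supported in a compact subset of `(0, 1)`. -/
def plCompact : Subgroup (ℝ ≃o ℝ) where
  carrier := {f | ∃ ε > 0, f ∈ plSupported ε (1 - ε)}
  one_mem' := ⟨1, one_pos, one_mem _⟩
  mul_mem' := by
    rintro f g ⟨ε, hε, hf⟩ ⟨η, hη, hg⟩
    exact ⟨min ε η, lt_min hε hη, mul_mem
      (plSupported_mono (min_le_left _ _) (by linarith [min_le_left ε η]) hf)
      (plSupported_mono (min_le_right _ _) (by linarith [min_le_right ε η]) hg)⟩
  inv_mem' := by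
    rintro f ⟨ε, hε, hf⟩
    exact ⟨ε, hε, inv_mem hf⟩

theorem plSupported_le_plCompact {a b : ℝ} (ha : 0 < a) (hb : b < 1) :
    plSupported a b ≤ plCompact := fun _ hf =>
  ⟨min a (1 - b), lt_min ha (by linarith),
    plSupported_mono (min_le_left _ _) (by linarith [min_le_right a (1 - b)]) hf⟩

theorem plCompact_le : plCompact ≤ plSupported 0 1 := by
  rintro f ⟨ε, hε, hf⟩
  exact plSupported_mono hε.le (by linarith) hf

theorem plCompact.isRealPL {f : ℝ ≃o ℝ} (hf : f ∈ plCompact) : IsRealPL f := (plCompact_le hf).1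

/-- Finitely many elements of `plCompact` are supported in a common compact interval. -/
theorem exists_common_support (l : List (ℝ ≃o ℝ)) (hl : ∀ f ∈ l, f ∈ plCompact) :
    ∃ u v : ℝ, 0 < u ∧ u < v ∧ v < 1 ∧ ∀ f ∈ l, f ∈ plSupported u v := by
  suffices H : ∃ ε : ℝ, 0 < ε ∧ ε < 1 / 2 ∧ ∀ f ∈ l, f ∈ plSupported ε (1 - ε) by
    obtain ⟨ε, h0, h1, h⟩ := H
    exact ⟨ε, 1 - ε, h0, by linarith, by linarith, h⟩
  induction l with
  | nil => exact ⟨1 / 4, by norm_num, by norm_num, by simp⟩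
  | cons f l ih =>
    obtain ⟨ε, h0, h1, h⟩ := ih fun g hg => hl g (List.mem_cons_of_mem _ hg)
    obtain ⟨η, hη, hf⟩ := hl f List.mem_cons_self
    refine ⟨min ε η, lt_min h0 hη, (min_le_left _ _).trans_lt h1, fun g hg => ?_⟩
    rcases List.mem_cons.1 hg with rfl | hg
    · exact plSupported_mono (min_le_right _ _) (by linarith [min_le_right ε η]) hf
    · exact plSupported_mono (min_le_left _ _) (by linarith [min_le_left ε η]) (h g hg)

/-! ### Moving compact intervals of (0,1) -/

/-- An element supported in `(c, d)` that contracts most of the interval towards `c`. -/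
theorem exists_squeeze {c d : ℝ} (hc : IsDyadicReal c) (hd : IsDyadicReal d) (hcd : c < d)
    (n : ℕ) : ∃ σ ∈ plSupported c d, ∀ x, c ≤ x → x ≤ d - (d - c) / 2 ^ n →
      σ x = c + (x - c) / 2 ^ n := by
  obtain ⟨q, hq, hq1, hqn⟩ : ∃ q : ℝ, 0 < q ∧ q ≤ 1 ∧ q = (2 : ℝ) ^ (-(n : ℤ)) :=
    ⟨_, by positivity, by
      rw [zpow_neg, zpow_natCast]; exact inv_le_one_of_one_le₀ (one_le_pow₀ one_le_two), rfl⟩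
  have hqi : (2 : ℝ) ^ (n : ℤ) = q⁻¹ := by rw [hqn, zpow_neg, inv_inv]
  have hdiv : ∀ x : ℝ, x / 2 ^ n = q * x := fun x => by
    rw [hqn, zpow_neg, zpow_natCast]; field_simp
  have hw : 0 < d - c := sub_pos.2 hcd
  have dy : ∀ x, IsDyadicReal x → IsDyadicReal (q * x) := fun x hx => hqn ▸ hx.zpow_mul _
  have hp₁ : IsDyadicReal (c + q * ((d - c) - q * (d - c))) :=
    hc.add (dy _ ((hd.sub hc).sub (dy _ (hd.sub hc))))
  have hp₂ : IsDyadicReal (c + q * (d - c)) := hc.add (dy _ (hd.sub hc))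
  have hq2 : 0 ≤ q * (d - c) * (1 - q) := by
    have : 0 ≤ 1 - q := by linarith
    positivity
  have hqq : q * (q * (d - c)) ≤ q * (d - c) := by nlinarith
  have hqw : q * (d - c) ≤ d - c := by nlinarith
  have hqqp : 0 < q * (q * (d - c)) := by positivity
  have e₀ : ∀ x, c ≤ x → kink c 0 (-n) x = c + q * (x - c) := fun x hx => by
    rw [kink_of_ge _ _ hx, hqn]
  have fix : ∀ z ≤ c + q * ((d - c) - q * (d - c)), kink d 0 (-n) (kink (c + q * (d - c)) 0 n
      (kink (c + q * ((d - c) - q * (d - c))) 0 n z)) = z := fun z hz => by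
    rw [kink_zero_of_le _ hz, kink_zero_of_le (x := z) _ (by nlinarith),
      kink_zero_of_le (x := z) _ (by nlinarith)]
  -- With q = 2⁻ⁿ the slope changes from 1 to q at c, then back to 1, then to q⁻¹, and to 1 again at
  -- d. The middle breakpoints are chosen so that d is fixed, and the first of them is the image of
  -- d - q(d - c).
  refine ⟨kink d 0 (-n) * kink (c + q * (d - c)) 0 n *
    kink (c + q * ((d - c) - q * (d - c))) 0 n * kink c 0 (-n), ⟨?_, ?_⟩, ?_⟩
  · exact ((((isRealPL_kink hd _ _)).mul (isRealPL_kink hp₂ _ _)).mul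
      (isRealPL_kink hp₁ _ _)).mul (isRealPL_kink hc _ _)
  · intro x hx
    simp only [RelIso.mul_apply]
    rcases le_or_gt x c with h | h
    · rw [kink_zero_of_le (p := c) _ h, fix x (by nlinarith)]
    · have h : d ≤ x := not_lt.1 fun h' => hx ⟨h, h'⟩
      have hqx : q * (d - c) ≤ q * (x - c) := by gcongr
      have h1 : kink (c + q * ((d - c) - q * (d - c))) 0 n (c + q * (x - c)) =
          c + q * ((d - c) - q * (d - c)) + ((x - c) - ((d - c) - q * (d - c))) := by
        rw [kink_of_ge _ _ (by nlinarith), hqi]; field_simp; ring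
      have h2 : kink (c + q * (d - c)) 0 n
          (c + q * ((d - c) - q * (d - c)) + ((x - c) - ((d - c) - q * (d - c)))) =
          d + q⁻¹ * (x - d) := by
        rw [kink_of_ge _ _ (by nlinarith), hqi]; field_simp; ring
      have hx' : 0 ≤ q⁻¹ * (x - d) := mul_nonneg (inv_nonneg.2 hq.le) (sub_nonneg.2 h)
      rw [e₀ x (by linarith), h1, h2, kink_of_ge _ _ (by linarith), ← hqn]
      field_simp; ring
  · intro x hx hx'
    rw [hdiv] at hx' ⊢
    have hm : q * (x - c) ≤ q * ((d - c) - q * (d - c)) :=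
      mul_le_mul_of_nonneg_left (by linarith) hq.le
    simp only [RelIso.mul_apply]
    rw [e₀ x hx, fix _ (by linarith)]

theorem exists_div_pow_two_lt {w ε : ℝ} (hw : 0 < w) (hε : 0 < ε) : ∃ n : ℕ, w / 2 ^ n < ε := by
  obtain ⟨n, hn⟩ := exists_pow_lt_of_lt_one (div_pos hε hw) (by norm_num : (1 / 2 : ℝ) < 1)
  refine ⟨n, ?_⟩
  rw [lt_div_iff₀ hw, one_div, inv_pow] at hn
  rwa [div_eq_inv_mul]

/-- Any compact interval of `(0, 1)` can be moved into any other one. -/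
theorem exists_compress {a b u v : ℝ} (ha : 0 < a) (hab : a < b) (hb : b < 1) (hu : 0 < u)
    (huv : u < v) (hv : v < 1) : ∃ h ∈ plCompact, a ≤ h u ∧ h v ≤ b := by
  obtain ⟨c, hc, hc0, hcm⟩ := exists_isDyadicReal_between (lt_min hu ha)
  have hcu := hcm.trans_le (min_le_left _ _)
  have hca := hcm.trans_le (min_le_right _ _)
  obtain ⟨d, hd, hvd, hd1⟩ := exists_isDyadicReal_between hv
  obtain ⟨c', hc', hc'0, hc'c⟩ := exists_isDyadicReal_between hc0
  obtain ⟨d', hd', had', hd'b⟩ := exists_isDyadicReal_between hab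
  obtain ⟨n, hn⟩ := exists_div_pow_two_lt (w := d - c) (ε := min (d - v) (a - c)) (by linarith)
    (lt_min (by linarith) (by linarith))
  obtain ⟨m, hm⟩ := exists_div_pow_two_lt (w := d' - c') (ε := min (c - c') (d' - a))
    (by linarith) (lt_min (by linarith) (by linarith))
  rw [lt_min_iff] at hn hm
  obtain ⟨σ, hσ, eσ⟩ := exists_squeeze hc hd (by linarith) n
  obtain ⟨τ, hτ, eτ⟩ := exists_squeeze hc' hd' (by linarith) m
  -- σ squeezes [u, v] into a short interval just right of c, below a. As τ sends d' - (d' - c')/2ᵐ,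
  -- which exceeds a, to below c, its inverse lifts everything from c on above a, while keeping
  -- points below d' < b.
  refine ⟨τ⁻¹ * σ, mul_mem (inv_mem (plSupported_le_plCompact hc'0 (by linarith) hτ))
    (plSupported_le_plCompact hc0 hd1 hσ), ?_, ?_⟩
  · have hσu : c ≤ σ u := (plSupported_mem_Ioo hσ ⟨hcu, by linarith⟩).1.le
    have e := eτ (d' - (d' - c') / 2 ^ m) (by linarith [hm.1]) le_rfl
    have h2 : (0 : ℝ) < 2 ^ m := by positivity
    have h3 : (d' - (d' - c') / 2 ^ m - c') / 2 ^ m ≤ (d' - c') / 2 ^ m := by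
      have : 0 ≤ (d' - c') / 2 ^ m := div_nonneg (by linarith) h2.le
      exact div_le_div_of_nonneg_right (by linarith) h2.le
    have h4 : d' - (d' - c') / 2 ^ m ≤ τ.symm (σ u) := by
      rw [OrderIso.le_symm_apply, e]; linarith [hm.1]
    change a ≤ τ.symm (σ u)
    linarith [hm.2]
  · have e := eσ v (by linarith) (by linarith [hn.1])
    have h3 : (v - c) / 2 ^ n ≤ (d - c) / 2 ^ n :=
      div_le_div_of_nonneg_right (by linarith) (by positivity)
    have h4 : τ.symm (σ v) ≤ d' := by
      rw [OrderIso.symm_apply_le, hτ.2 d' fun h => lt_irrefl _ h.2, e]; linarith [hn.2]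
    change τ.symm (σ v) ≤ b
    linarith

/-- Any compact interval of `(0, 1)` can be displaced to its right. -/
theorem exists_displace {u v : ℝ} (hu : 0 < u) (huv : u < v) (hv : v < 1) :
    ∃ t ∈ plCompact, v ≤ t u := by
  -- The target is just some interval between v and 1.
  obtain ⟨t, ht, h, -⟩ := exists_compress (a := (v + 1) / 2) (b := (v + 3) / 4) (by linarith)
    (by linarith) (by linarith) hu huv hv
  exact ⟨t, ht, by linarith⟩

/-! ### Commutators are compactly supported -/

theorem exists_gap (D : Finset ℝ) (p : ℝ) :
    ∃ ε > 0, ∀ d ∈ D, d ∉ Set.Ioo p (p + ε) ∧ d ∉ Set.Ioo (p - ε) p := by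
  classical
  induction D using Finset.induction_on with
  | empty => exact ⟨1, one_pos, by simp⟩
  | insert x D hx ih =>
    obtain ⟨ε, hε, h⟩ := ih
    have h' : ∀ η ≤ ε, ∀ d ∈ D, d ∉ Set.Ioo p (p + η) ∧ d ∉ Set.Ioo (p - η) p :=
      fun η hη d hd => ⟨fun hI => (h d hd).1 ⟨hI.1, by linarith [hI.2]⟩,
        fun hI => (h d hd).2 ⟨by linarith [hI.1], hI.2⟩⟩
    rcases eq_or_ne x p with rfl | hne
    · refine ⟨ε, hε, fun d hd => ?_⟩
      rcases Finset.mem_insert.1 hd with rfl | hd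
      · simp
      · exact h d hd
    · refine ⟨min ε |x - p|, lt_min hε (abs_pos.2 (sub_ne_zero.2 hne)), fun d hd => ?_⟩
      rcases Finset.mem_insert.1 hd with rfl | hd
      · have := min_le_right ε |d - p|
        refine ⟨fun hI => ?_, fun hI => ?_⟩
        · have e := abs_of_pos (sub_pos.2 hI.1)
          linarith [hI.2]
        · have e := abs_of_neg (sub_neg.2 hI.2)
          linarith [hI.1]
      · exact h' _ (min_le_left _ _) d hd

open Filter Topology in
/-- Germs at a fixed end `p` that are homotheties commute, so commutators have trivial germs. -/
theorem eventually_fixed_of_mem_commutator {H : Subgroup (ℝ ≃o ℝ)} {l : Filter ℝ} {p : ℝ}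
    (ht : ∀ f ∈ H, Tendsto f l l)
    (hH : ∀ f ∈ H, ∃ k : ℤ, ∀ᶠ x in l, f x = p + (2 : ℝ) ^ k * (x - p))
    {g : ℝ ≃o ℝ} (hg : g ∈ ⁅H, H⁆) : ∀ᶠ x in l, g x = x := by
  have key : ∀ a ∈ H, ∀ b ∈ H, ∀ᶠ x in l, ⁅a, b⁆ x = x := by
    intro a ha b hb
    obtain ⟨j, hj⟩ := hH a ha
    obtain ⟨k, hk⟩ := hH b hb
    have e : ∀ᶠ x in l, (a * b) x = (b * a) x := by
      filter_upwards [hj, hk, (ht b hb).eventually hj, (ht a ha).eventually hk] with x h1 h2 h3 h4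
      rw [RelIso.mul_apply, RelIso.mul_apply, h3, h4, h1, h2]
      ring
    -- The relation ab = ba near the end is evaluated at (ba)⁻¹x, which also tends to that end.
    filter_upwards [(ht _ (H.inv_mem (H.mul_mem hb ha))).eventually e] with x hx
    rw [RelIso.apply_inv_self] at hx
    rw [show ⁅a, b⁆ = a * b * (b * a)⁻¹ by rw [commutatorElement_def]; group, RelIso.mul_apply, hx]
  rw [Subgroup.commutator_def] at hg
  induction hg using Subgroup.closure_induction_left with
  | one => exact Eventually.of_forall fun _ => rfl
  | mul_left x hx y hy ih =>
    obtain ⟨a, ha, b, hb, rfl⟩ := hx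
    filter_upwards [key a ha b hb, ih] with z h1 h2
    rw [RelIso.mul_apply, h2, h1]
  | inv_mul_cancel x hx y hy ih =>
    obtain ⟨a, ha, b, hb, rfl⟩ := hx
    rw [commutatorElement_inv]
    filter_upwards [key b hb a ha, ih] with z h1 h2
    rw [RelIso.mul_apply, h2, h1]

open Filter Topology in
-- Breakpoints are finite in number, so every element is a homothety centred at 0 just right of 0,
-- and one centred at 1 just left of 1.
theorem exists_support_of_mem_commutator {g : ℝ ≃o ℝ}
    (hg : g ∈ ⁅plSupported 0 1, plSupported 0 1⁆) :
    ∃ ε > 0, ∀ x, x < ε ∨ 1 - ε < x → g x = x := by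
  have hgU : g ∈ plSupported 0 1 := commutator_self_le _ hg
  have h0 : ∀ f ∈ plSupported 0 1, f 0 = 0 := fun f hf => hf.2 0 (by simp)
  have h1 : ∀ f ∈ plSupported 0 1, f 1 = 1 := fun f hf => hf.2 1 (by simp)
  have A : ∀ᶠ x in 𝓝[>] (0 : ℝ), g x = x := by
    refine eventually_fixed_of_mem_commutator (p := 0) (fun f hf => ?_) (fun f hf => ?_) hg
    · refine tendsto_nhdsWithin_iff.2 ⟨?_, ?_⟩
      · have := f.continuous.tendsto 0
        rw [h0 f hf] at this
        exact this.mono_left nhdsWithin_le_nhds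
      · filter_upwards [self_mem_nhdsWithin] with x hx
        have := f.strictMono hx
        rwa [h0 f hf] at this
    · obtain ⟨-, D, -, h⟩ := hf.1
      obtain ⟨ε, hε, hD⟩ := exists_gap D 0
      obtain ⟨k, hk⟩ := h 0 ε fun d hd => by simpa using (hD d hd).1
      refine ⟨k, ?_⟩
      filter_upwards [Ioo_mem_nhdsGT hε] with x hx
      have := hk 0 ⟨le_rfl, hε.le⟩ x ⟨hx.1.le, hx.2.le⟩
      rw [h0 f hf] at this
      linarith
  have B : ∀ᶠ x in 𝓝[<] (1 : ℝ), g x = x := by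
    refine eventually_fixed_of_mem_commutator (p := 1) (fun f hf => ?_) (fun f hf => ?_) hg
    · refine tendsto_nhdsWithin_iff.2 ⟨?_, ?_⟩
      · have := f.continuous.tendsto 1
        rw [h1 f hf] at this
        exact this.mono_left nhdsWithin_le_nhds
      · filter_upwards [self_mem_nhdsWithin] with x hx
        have := f.strictMono hx
        rwa [h1 f hf] at this
    · obtain ⟨-, D, -, h⟩ := hf.1
      obtain ⟨ε, hε, hD⟩ := exists_gap D 1
      obtain ⟨k, hk⟩ := h (1 - ε) 1 fun d hd => (hD d hd).2
      refine ⟨k, ?_⟩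
      filter_upwards [Ioo_mem_nhdsLT (show 1 - ε < 1 by linarith)] with x hx
      have := hk 1 ⟨by linarith, le_rfl⟩ x ⟨hx.1.le, hx.2.le⟩
      rw [h1 f hf] at this
      linarith
  obtain ⟨α, hα, hA⟩ := mem_nhdsGT_iff_exists_Ioo_subset.1 A
  obtain ⟨β, hβ, hB⟩ := mem_nhdsLT_iff_exists_Ioo_subset.1 B
  have hα : 0 < α := hα
  have hβ : β < 1 := hβ
  refine ⟨min α (1 - β), lt_min hα (by linarith), fun x hx => ?_⟩
  by_cases hI : x ∈ Set.Ioo (0 : ℝ) 1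
  · rcases hx with hx | hx
    · exact hA ⟨hI.1, hx.trans_le (min_le_left _ _)⟩
    · exact hB ⟨by linarith [min_le_right α (1 - β)], hI.2⟩
  · exact hgU.2 x hI

/-- The commutator subgroup of `plSupported 0 1` is exhausted by those of `plSupported u v`. -/
theorem exists_mem_commutator_plSupported {g : ℝ ≃o ℝ}
    (hg : g ∈ ⁅plSupported 0 1, plSupported 0 1⁆) :
    ∃ u v : ℝ, 0 < u ∧ u < v ∧ v < 1 ∧ g ∈ ⁅plSupported u v, plSupported u v⁆ := by
  obtain ⟨ε, hε, h⟩ := exists_support_of_mem_commutator hg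
  obtain ⟨δ, hδ, hδ0, hδm⟩ := exists_isDyadicReal_between (lt_min hε (by norm_num : (0 : ℝ) < 1/2))
  rw [lt_min_iff] at hδm
  -- A has slope 1/2 outside [δ, 1 - δ]. It is the identity on the support of g, so it centralizes
  -- g, while conjugation by it carries all of `plSupported 0 1` into a group with compact support
  -- in (0,1).
  obtain ⟨A, hA, hAid, hA0, hA1⟩ : ∃ A : ℝ ≃o ℝ, IsRealPL A ∧
      (∀ x ∈ Set.Icc δ (1 - δ), A x = x) ∧ A 0 = δ / 2 ∧ A 1 = 1 - δ / 2 := by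
    refine ⟨kink δ (-1) 0 * kink (1 - δ) 0 (-1), (isRealPL_kink hδ _ _).mul
      (isRealPL_kink (IsDyadicReal.one.sub hδ) _ _), fun x hx => ?_, ?_, ?_⟩
    · rw [RelIso.mul_apply, kink_zero_of_le (p := 1 - δ) _ hx.2, kink_of_ge _ _ hx.1]
      simp
    · rw [RelIso.mul_apply, kink_zero_of_le (p := 1 - δ) _ (by linarith),
        kink_of_le _ _ hδ0.le]
      norm_num; ring
    · have e : kink (1 - δ) 0 (-1) 1 = 1 - δ / 2 := by
        rw [kink_of_ge _ _ (by linarith)]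
        norm_num; ring
      rw [RelIso.mul_apply, e, kink_of_ge _ _ (by linarith)]
      norm_num
  refine ⟨δ / 2, 1 - δ / 2, by linarith, by linarith, by linarith, ?_⟩
  have hgδ : g ∈ plSupported δ (1 - δ) := by
    refine ⟨(commutator_self_le _ hg).1, fun x hx => h x ?_⟩
    rcases le_or_gt x δ with h' | h'
    · left; linarith
    · right
      have : 1 - δ ≤ x := not_lt.1 fun h'' => hx ⟨h', h''⟩
      linarith
  have hAg : A * g * A⁻¹ = g := by
    rw [mul_inv_eq_iff_eq_mul]
    ext x
    rw [RelIso.mul_apply, RelIso.mul_apply]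
    by_cases hx : x ∈ Set.Ioo δ (1 - δ)
    · rw [hAid x (Set.Ioo_subset_Icc_self hx),
        hAid _ (Set.Ioo_subset_Icc_self (plSupported_mem_Ioo hgδ hx))]
    · rw [hgδ.2 x hx, hgδ.2]
      intro hI
      have e : A (A x) = A x := hAid _ (Set.Ioo_subset_Icc_self hI)
      rw [A.injective e] at hI
      exact hx hI
  have hmap : (plSupported 0 1).map (MulAut.conj A).toMonoidHom ≤
      plSupported (δ / 2) (1 - δ / 2) := by
    rintro _ ⟨f, hf, rfl⟩
    have := plSupported_conj hA hf
    rwa [hA0, hA1] at this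
  have := Subgroup.mem_map_of_mem (MulAut.conj A).toMonoidHom hg
  rw [Subgroup.map_commutator] at this
  have e : (MulAut.conj A).toMonoidHom g = g := hAg
  rw [e] at this
  exact Subgroup.commutator_mono hmap hmap this

/-! ### Six conjugates suffice -/

/-- The interval between a moved point and its image is carried off itself, by monotonicity. -/
theorem exists_displaced_interval {f : ℝ ≃o ℝ} (hf : f ∈ plSupported 0 1) (hne : f ≠ 1) :
    ∃ a b : ℝ, 0 < a ∧ a < b ∧ b < 1 ∧ (b ≤ f a ∨ f b ≤ a) := by
  obtain ⟨x, hx⟩ : ∃ x, f x ≠ x := by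
    by_contra! h
    exact hne (RelIso.ext h)
  have hI : x ∈ Set.Ioo (0 : ℝ) 1 := by
    by_contra h
    exact hx (hf.2 x h)
  have hfI := plSupported_mem_Ioo hf hI
  rcases lt_or_gt_of_ne hx with h | h
  · exact ⟨f x, x, hfI.1, h, hI.2, Or.inr le_rfl⟩
  · exact ⟨x, f x, hI.1, h, hfI.2, Or.inl le_rfl⟩

/-- Conjugation by a compactly supported element can be realized by a commutator. -/
theorem exists_commutator_conj_eq {f k : ℝ ≃o ℝ} (hf : f ∈ plCompact) (hk : k ∈ plCompact) :
    ∃ d ∈ ⁅plSupported 0 1, plSupported 0 1⁆, d * f * d⁻¹ = k * f * k⁻¹ := by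
  obtain ⟨u, v, hu, huv, hv, h⟩ := exists_common_support [f, k] (by simp [hf, hk])
  obtain ⟨t, ht, htu⟩ := exists_displace hu huv hv
  refine ⟨⁅k, t⁆, Subgroup.commutator_mem_commutator (plCompact_le hk) (plCompact_le ht), ?_⟩
  -- t pushes the support of k⁻¹ past that of f, so the second factor of ⁅k, t⁆ = k(tk⁻¹t⁻¹)
  -- centralizes f.
  have hc := (plSupported_commute (h f (by simp))
    (plSupported_conj (plCompact.isRealPL ht) (inv_mem (h k (by simp)))) htu).eq
  calc ⁅k, t⁆ * f * ⁅k, t⁆⁻¹ = k * ((t * k⁻¹ * t⁻¹) * f) * (t * k⁻¹ * t⁻¹)⁻¹ * k⁻¹ := by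
        rw [commutatorElement_def]; group
    _ = k * f * k⁻¹ := by rw [← hc]; group

theorem exists_six_conjugates {f g : ℝ ≃o ℝ} (hf : f ∈ ⁅plSupported 0 1, plSupported 0 1⁆)
    (hne : f ≠ 1) (hg : g ∈ ⁅plSupported 0 1, plSupported 0 1⁆) :
    ∃ l : List (ℝ ≃o ℝ), l.length ≤ 6 ∧
      (∀ s ∈ l, ∃ d ∈ ⁅plSupported 0 1, plSupported 0 1⁆,
        s = d * f * d⁻¹ ∨ s = d * f⁻¹ * d⁻¹) ∧ l.prod = g := by
  have hfK : f ∈ plCompact := by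
    obtain ⟨u, v, hu, -, hv, h⟩ := exists_mem_commutator_plSupported hf
    exact plSupported_le_plCompact hu hv (commutator_self_le _ h)
  obtain ⟨u, v, hu, huv, hv, hg⟩ := exists_mem_commutator_plSupported hg
  obtain ⟨t, ht, htu⟩ := exists_displace hu huv hv
  have ht1 : t 1 = 1 := (plCompact_le ht).2 1 (by simp)
  have hconj : ∀ m ∈ plCompact ⊓ plSupported u 1, t * m * t⁻¹ ∈ plSupported v 1 := by
    intro m hm
    have := plSupported_conj (plCompact.isRealPL ht) hm.2
    exact plSupported_mono htu ht1.le this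
  -- The iterated shifts by t need not stay in (u, v), so M bounds supports only on the left by u
  -- and otherwise just asks for compactness.
  obtain ⟨α, hα, β, hβ, w, hw, e⟩ := exists_eq_two_commutators (t := t)
    (M := plCompact ⊓ plSupported u 1)
    (le_inf (plSupported_le_plCompact hu hv) (plSupported_mono le_rfl hv.le))
    (fun m hm => ⟨plCompact.mul_mem (plCompact.mul_mem ht hm.1) (plCompact.inv_mem ht),
      plSupported_mono huv.le le_rfl (hconj m hm)⟩)
    (fun p hp m hm => plSupported_commute hp (hconj m hm) le_rfl) hg
  have hαK : α ∈ plCompact := hα.1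
  have hβK : β ∈ plCompact := hβ.1
  have hwK : w ∈ plCompact := hw.1
  obtain ⟨u', v', hu', huv', hv', hsupp⟩ := exists_common_support [α, β, w, t]
    (by simp [hαK, hβK, hwK, ht])
  obtain ⟨a, b, ha, hab, hb, hfab⟩ := exists_displaced_interval (plCompact_le hfK) hne
  -- Conjugation by h brings α, β, w and t all into the interval displaced by f; it is undone at the
  -- end by h⁻¹.
  obtain ⟨h, hh, hua, hvb⟩ := exists_compress ha hab hb hu' huv' hv'
  have hin : ∀ x ∈ [α, β, w, t], h * x * h⁻¹ ∈ plSupported a b := fun x hx =>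
    plSupported_mono hua hvb (plSupported_conj (plCompact.isRealPL hh) (hsupp x hx))
  have hdisj : ∀ x ∈ plSupported a b, ∀ y ∈ plSupported a b, Commute x (f * y * f⁻¹) := by
    intro x hx y hy
    have hy' := plSupported_conj (plCompact.isRealPL hfK) hy
    rcases hfab with h | h
    · exact plSupported_commute hx hy' h
    · exact (plSupported_commute hy' hx h).symm
  obtain ⟨l, hl, hls, hlp⟩ := two_commutators_eq_six_conjugates (plSupported_le_plCompact ha hb)
    hfK hdisj (hin α (by simp)) (hin β (by simp)) (hin w (by simp)) (hin t (by simp))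
  refine ⟨l.map (MulAut.conj h⁻¹), by simpa using hl, ?_, ?_⟩
  · intro s hs
    obtain ⟨s, hs', rfl⟩ := List.mem_map.1 hs
    obtain ⟨k, hk, hsk⟩ := hls s hs'
    -- The conjugator h⁻¹k is only compactly supported; d does the same to f, hence to f⁻¹, from
    -- within the commutator subgroup.
    obtain ⟨d, hd, hdk⟩ := exists_commutator_conj_eq hfK (mul_mem (inv_mem hh) hk)
    refine ⟨d, hd, hsk.imp ?_ ?_⟩
    · rintro rfl
      rw [hdk, MulAut.conj_apply]; group
    · rintro rfl
      rw [show d * f⁻¹ * d⁻¹ = (d * f * d⁻¹)⁻¹ from conj_inv.symm, hdk, MulAut.conj_apply]; group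
  · rw [← map_list_prod, hlp, e, MulAut.conj_apply]
    simp only [commutatorElement_def]; group

/-! ### Thompson's group as a group of homeomorphisms of the line -/

/-- The extension of a self-map of `[0, 1]` by the identity. -/
noncomputable def extendFun (f : unitInterval → unitInterval) (x : ℝ) : ℝ :=
  open Classical in if h : x ∈ unitInterval then (f ⟨x, h⟩ : ℝ) else x

theorem extendFun_coe (f : unitInterval → unitInterval) (x : unitInterval) :
    extendFun f x = f x := dif_pos x.2

theorem extendFun_of_notMem (f : unitInterval → unitInterval) {x : ℝ} (h : x ∉ unitInterval) :
    extendFun f x = x := dif_neg h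

theorem extendFun_comp (f g : unitInterval → unitInterval) (x : ℝ) :
    extendFun f (extendFun g x) = extendFun (f ∘ g) x := by
  by_cases h : x ∈ unitInterval
  · lift x to unitInterval using h
    simp only [extendFun_coe, Function.comp]
  · simp only [extendFun_of_notMem _ h]

theorem extendFun_id (x : ℝ) : extendFun id x = x := by
  by_cases h : x ∈ unitInterval
  · lift x to unitInterval using h
    rw [extendFun_coe, id]
  · exact extendFun_of_notMem _ h

theorem extendFun_strictMono {f : unitInterval → unitInterval} (hf : StrictMono f) :
    StrictMono (extendFun f) := by
  intro x y hxy
  by_cases hx : x ∈ unitInterval <;> by_cases hy : y ∈ unitInterval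
  · lift x to unitInterval using hx
    lift y to unitInterval using hy
    rw [extendFun_coe, extendFun_coe]
    exact hf hxy
  · lift x to unitInterval using hx
    rw [extendFun_coe, extendFun_of_notMem _ hy]
    have : 1 < y := not_le.1 fun h => hy ⟨x.2.1.trans hxy.le, h⟩
    exact (f x).2.2.trans_lt this
  · lift y to unitInterval using hy
    rw [extendFun_coe, extendFun_of_notMem _ hx]
    have : x < 0 := not_le.1 fun h => hx ⟨h, hxy.le.trans y.2.2⟩
    exact this.trans_le (f y).2.1
  · rwa [extendFun_of_notMem _ hx, extendFun_of_notMem _ hy]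

/-- Extension by the identity, as a homomorphism. -/
noncomputable def extendHom : (unitInterval ≃o unitInterval) →* (ℝ ≃o ℝ) where
  toFun f := (extendFun_strictMono f.strictMono).orderIsoOfRightInverse _ (extendFun f.symm)
    fun x => by
      rw [extendFun_comp, show f ∘ f.symm = id from funext f.apply_symm_apply, extendFun_id]
  map_one' := RelIso.ext extendFun_id
  map_mul' f g := RelIso.ext fun x => (extendFun_comp f g x).symm

theorem extendHom_coe (f : unitInterval ≃o unitInterval) (x : unitInterval) :
    extendHom f x = f x := extendFun_coe f x

theorem extendHom_of_notMem (f : unitInterval ≃o unitInterval) {x : ℝ} (h : x ∉ unitInterval) :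
    extendHom f x = x := extendFun_of_notMem f h

theorem extendHom_injective : Function.Injective extendHom := by
  intro f g h
  refine RelIso.ext fun x => Subtype.ext ?_
  rw [← extendHom_coe, h, extendHom_coe]

theorem extendHom_of_notMem_Ioo (f : unitInterval ≃o unitInterval) {x : ℝ}
    (h : x ∉ Set.Ioo (0 : ℝ) 1) : extendHom f x = x := by
  by_cases hx : x ∈ unitInterval
  · rcases hx.1.eq_or_lt with rfl | h0
    · have := extendHom_coe f 0
      rwa [show f 0 = 0 from f.map_bot] at this
    · have h1 : x = 1 := hx.2.antisymm (not_lt.1 fun h1 => h ⟨h0, h1⟩)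
      have := extendHom_coe f 1
      rw [show f 1 = 1 from f.map_top] at this
      rw [h1]; exact this
  · exact extendHom_of_notMem f hx

theorem isRealPL_extendHom {f : unitInterval ≃o unitInterval} (hf : IsPLTwo f) :
    IsRealPL (extendHom f) := by
  classical
  have dy : ∀ {f : unitInterval ≃o unitInterval}, IsPLTwo f → ∀ x, IsDyadicReal x →
      IsDyadicReal (extendHom f x) := by
    intro f hf x hx
    by_cases h : x ∈ unitInterval
    · lift x to unitInterval using h
      rw [extendHom_coe]
      exact hf.dyadic x hx
    · rwa [extendHom_of_notMem f h]
  refine ⟨fun x => ⟨fun h => ?_, dy hf x⟩, ?_⟩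
  · have := dy hf.inv _ h
    rwa [map_inv, RelIso.inv_apply_self] at this
  obtain ⟨D, hD, h⟩ := hf
  -- The extension by the identity may acquire breakpoints at 0 and 1.
  refine ⟨insert 0 (insert 1 (D.image (↑))), ?_, fun a b hab => ?_⟩
  · intro d hd
    simp only [Finset.mem_insert, Finset.mem_image] at hd
    rcases hd with rfl | rfl | ⟨e, he, rfl⟩
    exacts [IsDyadicReal.zero, IsDyadicReal.one, hD e he]
  · have h0 : ¬ (a < 0 ∧ 0 < b) := hab 0 (by simp)
    have h1 : ¬ (a < 1 ∧ 1 < b) := hab 1 (by simp)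
    by_cases hout : b ≤ 0 ∨ 1 ≤ a
    · have fix : ∀ x ∈ Set.Icc a b, extendHom f x = x := fun x hx =>
        extendHom_of_notMem_Ioo f fun hI => hout.elim
          (fun h => (hI.1.trans_le (hx.2.trans h)).false)
          (fun h => (hI.2.trans_le (h.trans hx.1)).false)
      exact ⟨0, fun x hx y hy => by rw [fix x hx, fix y hy]; simp⟩
    · rw [not_or, not_le, not_le] at hout
      have ha : 0 ≤ a := not_lt.1 fun ha => h0 ⟨ha, hout.1⟩
      have hb : b ≤ 1 := not_lt.1 fun hb => h1 ⟨hout.2, hb⟩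
      obtain ⟨k, hk⟩ := h ⟨a, ha, hout.2.le⟩ ⟨b, hout.1.le, hb⟩ fun d hd hI =>
        hab d (Finset.mem_insert_of_mem (Finset.mem_insert_of_mem
          (Finset.mem_image_of_mem _ hd))) hI
      refine ⟨k, fun x hx y hy => ?_⟩
      lift x to unitInterval using ⟨ha.trans hx.1, hx.2.trans hb⟩
      lift y to unitInterval using ⟨ha.trans hy.1, hy.2.trans hb⟩
      rw [extendHom_coe, extendHom_coe]
      exact hk x hx y hy

theorem plSupported_mem_unitInterval {h : ℝ ≃o ℝ} (hh : h ∈ plSupported 0 1) {x : ℝ}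
    (hx : x ∈ unitInterval) : h x ∈ unitInterval := by
  by_cases hI : x ∈ Set.Ioo (0 : ℝ) 1
  · exact Set.Ioo_subset_Icc_self (plSupported_mem_Ioo hh hI)
  · rwa [hh.2 x hI]

theorem exists_extendHom_eq {h : ℝ ≃o ℝ} (hh : h ∈ plSupported 0 1) :
    ∃ f, IsPLTwo f ∧ extendHom f = h := by
  classical
  refine ⟨StrictMono.orderIsoOfRightInverse
    (fun x : unitInterval => (⟨h x, plSupported_mem_unitInterval hh x.2⟩ : unitInterval))
    (fun x y hxy => h.strictMono hxy)
    (fun x => ⟨h⁻¹ x, plSupported_mem_unitInterval (inv_mem hh) x.2⟩)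
    (fun x => Subtype.ext (h.apply_symm_apply x)), ?_, ?_⟩
  · obtain ⟨-, D, hD, H⟩ := hh.1
    refine ⟨D.subtype (· ∈ unitInterval), fun d hd => hD d (Finset.mem_subtype.1 hd),
      fun a b hab => ?_⟩
    obtain ⟨k, hk⟩ := H a b fun d hd hI =>
      hab ⟨d, a.2.1.trans hI.1.le, hI.2.le.trans b.2.2⟩ (Finset.mem_subtype.2 hd) hI
    exact ⟨k, fun x hx y hy => hk x hx y hy⟩
  · refine RelIso.ext fun x => ?_
    by_cases hx : x ∈ unitInterval
    · lift x to unitInterval using hx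
      rw [extendHom_coe]
      rfl
    · rw [extendHom_of_notMem _ hx, hh.2 x fun hI => hx (Set.Ioo_subset_Icc_self hI)]

theorem map_extendHom_thompsonF : thompsonF.map extendHom = plSupported 0 1 := by
  ext h
  constructor
  · rintro ⟨f, hf, rfl⟩
    exact ⟨isRealPL_extendHom hf, fun x hx => extendHom_of_notMem_Ioo f hx⟩
  · intro hh
    obtain ⟨f, hf, rfl⟩ := exists_extendHom_eq hh
    exact ⟨f, hf, rfl⟩

/-- The commutator subgroup of Thompson's group, acting on the line. -/
noncomputable def commutatorHom : commutator thompsonF →* (ℝ ≃o ℝ) :=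
  (extendHom.comp thompsonF.subtype).comp (commutator thompsonF).subtype

theorem commutatorHom_injective : Function.Injective commutatorHom :=
  (extendHom_injective.comp Subtype.val_injective).comp Subtype.val_injective

theorem range_commutatorHom : commutatorHom.range = ⁅plSupported 0 1, plSupported 0 1⁆ := by
  rw [commutatorHom, MonoidHom.range_comp, Subgroup.range_subtype, commutator_def,
    Subgroup.map_commutator, ← MonoidHom.range_eq_map, MonoidHom.range_comp,
    Subgroup.range_subtype, map_extendHom_thompsonF]

theorem List.exists_map_eq_of_forall {α β : Type*} {φ : α → β} {p : α → Prop} (l : List β)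
    (h : ∀ b ∈ l, ∃ a, p a ∧ φ a = b) : ∃ l' : List α, (∀ a ∈ l', p a) ∧ l'.map φ = l := by
  induction l with
  | nil => exact ⟨[], by simp⟩
  | cons b l ih =>
    obtain ⟨a, ha, rfl⟩ := h b List.mem_cons_self
    obtain ⟨l', hl', rfl⟩ := ih fun b hb => h b (List.mem_cons_of_mem _ hb)
    exact ⟨a :: l', by simpa [ha] using hl', rfl⟩

theorem thompsonF_commutator_six_conjugates (f : commutator thompsonF) (hf : f ≠ 1)
    (g : commutator thompsonF) : ∃ l : List (commutator thompsonF), l.length ≤ 6 ∧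
      (∀ x ∈ l, x ∈ conjugatesOf f ∪ (conjugatesOf f)⁻¹) ∧ l.prod = g := by
  have mem : ∀ x, commutatorHom x ∈ ⁅plSupported 0 1, plSupported 0 1⁆ := fun x =>
    range_commutatorHom ▸ ⟨x, rfl⟩
  obtain ⟨l, hl, hls, hlp⟩ := exists_six_conjugates (mem f)
    (fun h => hf (commutatorHom_injective (h.trans (map_one _).symm))) (mem g)
  obtain ⟨l', hl', rfl⟩ := l.exists_map_eq_of_forall (φ := commutatorHom)
    (p := (· ∈ conjugatesOf f ∪ (conjugatesOf f)⁻¹)) (by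
      intro s hs
      obtain ⟨d, hd, h⟩ := hls s hs
      rw [← range_commutatorHom] at hd
      obtain ⟨d, rfl⟩ := hd
      rcases h with rfl | rfl
      · exact ⟨d * f * d⁻¹, Or.inl (isConj_iff.2 ⟨d, rfl⟩), by simp only [map_mul, map_inv]⟩
      · refine ⟨d * f⁻¹ * d⁻¹, Or.inr (isConj_iff.2 ⟨d, ?_⟩), by simp only [map_mul, map_inv]⟩
        rw [← conj_inv, inv_inv])
  refine ⟨l', by simpa using hl, hl', commutatorHom_injective ?_⟩
  rw [map_list_prod, hlp]

/-! ### Finite width -/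

theorem groupWidth_le {G : Type*} [Group G] {S : Set G} (n : ℕ)
    (h : ∀ g : G, ∃ l : List G, l.length ≤ n ∧ (∀ x ∈ l, x ∈ S ∪ S⁻¹) ∧ l.prod = g) :
    groupWidth G S ≤ n := by
  refine iSup_le fun g => ?_
  obtain ⟨l, hl, hS, hg⟩ := h g
  exact (iInf₂_le l ⟨hS, hg⟩).trans (by exact_mod_cast hl)

/-- A group in which every element is a product of boundedly many conjugates of any nontrivial
element and its inverse has finite `C`-width. -/
theorem hasFiniteCWidth_of_conjugates {G : Type*} [Group G] (n : ℕ)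
    (h : ∀ f : G, f ≠ 1 → ∀ g : G, ∃ l : List G, l.length ≤ n ∧
      (∀ x ∈ l, x ∈ conjugatesOf f ∪ (conjugatesOf f)⁻¹) ∧ l.prod = g) : HasFiniteCWidth G := by
  intro S hS hconj
  refine ne_top_of_le_ne_top (ENat.natCast_ne_top n) (groupWidth_le n fun g => ?_)
  by_cases hne : ∃ f ∈ S, f ≠ 1
  · obtain ⟨f, hfS, hf⟩ := hne
    have hsub : conjugatesOf f ⊆ S := by
      intro x hx
      obtain ⟨c, rfl⟩ := isConj_iff.1 hx
      exact hconj c f hfS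
    obtain ⟨l, hl, hlf, hg⟩ := h f hf g
    exact ⟨l, hl, fun x hx => (hlf x hx).imp (fun h => hsub h) (fun h => hsub h), hg⟩
  -- A generating set without nonidentity elements forces the group to be trivial.
  · push Not at hne
    have : Subgroup.closure S ≤ ⊥ := (Subgroup.closure_le _).2 fun x hx => hne x hx
    rw [hS] at this
    have hg : g = 1 := this (Subgroup.mem_top g)
    exact ⟨[], by simp, by simp, hg.symm⟩

theorem mainTheorem1 :
    (∀ f : commutator thompsonF, f ≠ 1 → ∀ g : commutator thompsonF,
      ∃ l : List (commutator thompsonF), l.length ≤ 6 ∧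
        (∀ x ∈ l, x ∈ conjugatesOf f ∪ (conjugatesOf f)⁻¹) ∧ l.prod = g) ∧
    HasFiniteCWidth (commutator thompsonF) :=
  ⟨thompsonF_commutator_six_conjugates,
    hasFiniteCWidth_of_conjugates 6 thompsonF_commutator_six_conjugates⟩
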